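/- For $c\in\mathbb{R}^5$ let $Q(c)=\{x\in\mathbb{R}^5 : |x_i-c_i|\le \tfrac12 \text{ for all } i\}$ be the closed unit cube centred at $c$, and let the cross centred at $c$ be $$K(c)=Q(c)\cup\bigcup_{i=1}^{5}\bigl(Q(c+e_i)\cup Q(c-e_i)\bigr),$$ that is, the union of $Q(c)$ and its reflections in its ten facets, where $e_1,\dots,e_5$ is the standard basis. A tiling of $\mathbb{R}^5$ by crosses is a set of crosses that covers $\mathbb{R}^5$ and whose members have pairwise disjoint interiors; it is a $\mathbb{Z}$-tiling if the centres of all its crosses have integer coordinates. Two tilings are congruent if some distance-preserving affine bijection of $\mathbb{R}^5$ maps the set of crosses of the first onto the set of crosses of the second. Theorem. There exists, up to congruence, a unique $\mathbb{Z}$-tiling of $\mathbb{R}^5$ by crosses: such a tiling exists, and any two such tilings are congruent. -/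

import Mathlib

/-- The closed axis-parallel unit cube in `ℝⁿ` with centre `c`. -/
def unitCube {n : ℕ} (c : EuclideanSpace ℝ (Fin n)) : Set (EuclideanSpace ℝ (Fin n)) :=
  {x | ∀ i, |x i - c i| ≤ 1 / 2}

/-- The `n`-dimensional cross with centre `c`: the unit cube centred at `c` together with its
reflections in all of its `2 * n` facets. -/
def cross {n : ℕ} (c : EuclideanSpace ℝ (Fin n)) : Set (EuclideanSpace ℝ (Fin n)) :=
  unitCube c ∪
    ⋃ i : Fin n, (unitCube (c + EuclideanSpace.single i (1 : ℝ)) ∪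
      unitCube (c - EuclideanSpace.single i (1 : ℝ)))

/-- A tiling of `ℝⁿ` by crosses: a family of crosses that cover the space and whose interiors
are pairwise disjoint. -/
structure IsCrossTiling {n : ℕ} (L : Set (Set (EuclideanSpace ℝ (Fin n)))) : Prop where
  isCross : ∀ K ∈ L, ∃ c, K = cross c
  covers : ⋃₀ L = Set.univ
  disjoint_interiors : L.Pairwise fun K K' => Disjoint (interior K) (interior K')

/-- A `ℤ`-tiling of `ℝⁿ` by crosses: the centres of all its crosses have integer coordinates. -/
structure IsZCrossTiling {n : ℕ} (L : Set (Set (EuclideanSpace ℝ (Fin n)))) : Prop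
    extends IsCrossTiling L where
  integer_centres : ∀ c, cross c ∈ L → ∀ i, ∃ z : ℤ, c i = z

/-- Two families of subsets of `ℝⁿ` are congruent if some (affine, bijective) isometry of `ℝⁿ`
maps the members of the first onto the members of the second. -/
def CongruentTilings {n : ℕ} (L L' : Set (Set (EuclideanSpace ℝ (Fin n)))) : Prop :=
  ∃ f : EuclideanSpace ℝ (Fin n) ≃ᵃⁱ[ℝ] EuclideanSpace ℝ (Fin n), (fun K => f '' K) '' L = L'

/-! A `ℤ`-tiling amounts to a set `T ⊆ ℤ⁵` of centres such that every integer point is uniquely a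
centre plus one of the 11 cells `0, ±e_i`. As 11 is prime, Frobenius in the group algebra over
`ℤ/11` makes `T` periodic modulo `11ℤ⁵` (`IsTile.sub_nsmul_mem`), so `T` comes from a tile set `U`
in `(ℤ/11)⁵`. The same argument modulo 2 shows that `U` also tiles with every nonzero multiple of
the cross (`IsTile.nsmul_prime`), which forbids differences of elements of `U` proportional to a
difference of two cells.

Hence `U` is the graph of a function, and its restriction to a line along any other axis solves the
toroidal queens problem on the `11 × 11` board. An exhaustive search shows all such solutions to be
affine (`toroidalQueens_affine`). Being affine with nonzero slope on every axis line, the function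
is affine (`exists_affine_of_affine_on_axes`), so `U` is a hyperplane. Its coefficients are `±1, …,
±5` in some order, and a signed coordinate permutation with a translation carries the standard
lattice onto `T`. -/

/-! ### Toroidal queens on the `11 × 11` board -/

/-- A queen in row `v` of a toroidal `11 × 11` board is not attacked by the queens whose rows are
listed in the last argument, the first of which stands `d` columns to the left, the second `d + 1`
columns, and so on. -/
def queenSafe (v : ℕ) : ℕ → List ℕ → Bool
  | _, [] => true
  | d, w :: l => v != w && (v + d) % 11 != w && v != (w + d) % 11 && queenSafe v (d + 1) l

/-- The placements of mutually non-attacking queens in the columns `0, …, k` of a toroidal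
`11 × 11` board, with row `0` in column `0`; the last column comes first. -/
def queenPlacements : ℕ → List (List ℕ)
  | 0 => [[0]]
  | k + 1 => (queenPlacements k).flatMap fun l =>
      ((List.range 11).filter fun v => queenSafe v 1 l).map fun v => v :: l

theorem queenPlacements_ten :
    ∀ l ∈ queenPlacements 10,
      ∃ m ∈ List.range 11, l = (List.range 11).reverse.map fun x => m * x % 11 := by
  decide +kernel

/-- The values of `g` at `k, k - 1, …, 0`. -/
def valuesDown (g : ZMod 11 → ZMod 11) : ℕ → List ℕ
  | 0 => [(g 0).val]
  | k + 1 => (g (k + 1 : ℕ)).val :: valuesDown g k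

theorem valuesDown_eq_map (g : ZMod 11 → ZMod 11) (k : ℕ) :
    valuesDown g k = (List.range (k + 1)).reverse.map fun x => (g (x : ℕ)).val := by
  induction k with
  | zero => simp [valuesDown]
  | succ k ih => rw [valuesDown, ih, List.range_succ (n := k + 1)]; simp

/-- The three tests in `queenSafe` express injectivity of `g`, `g + x` and `g - x`. The bound `k + d
< 11` keeps the compared columns distinct modulo 11. -/
theorem queenSafe_valuesDown {g : ZMod 11 → ZMod 11} (hg : g.Injective)
    (hadd : (fun x => g x + x).Injective) (hsub : (fun x => g x - x).Injective) (k d : ℕ)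
    (hd : 0 < d) (hkd : k + d < 11) :
    queenSafe (g (k + d : ℕ)).val d (valuesDown g k) = true := by
  have key : ∀ (k d : ℕ), 0 < d → k + d < 11 → (g (k + d : ℕ)).val ≠ (g (k : ℕ)).val ∧
      ((g (k + d : ℕ)).val + d) % 11 ≠ (g (k : ℕ)).val ∧
      (g (k + d : ℕ)).val ≠ ((g (k : ℕ)).val + d) % 11 := by
    intro k d hd hkd
    have hne : ((k + d : ℕ) : ZMod 11) ≠ (k : ℕ) := by
      intro h
      rw [ZMod.natCast_eq_natCast_iff'] at h
      omega
    refine ⟨fun h => hne (hg (ZMod.val_injective _ h)), fun h => hne (hadd ?_),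
      fun h => hne (hsub ?_)⟩
    · have := congrArg (Nat.cast : ℕ → ZMod 11) h
      simp only [ZMod.natCast_mod, Nat.cast_add, ZMod.natCast_zmod_val] at this
      push_cast
      linear_combination this
    · have := congrArg (Nat.cast : ℕ → ZMod 11) h
      simp only [ZMod.natCast_mod, Nat.cast_add, ZMod.natCast_zmod_val] at this
      push_cast
      linear_combination this
  induction k generalizing d with
  | zero =>
    have := key 0 d hd hkd
    simp_all [valuesDown, queenSafe]
  | succ k ih =>
    have h1 := key (k + 1) d hd hkd
    have h2 := ih (d + 1) (by omega) (by omega)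
    rw [show k + (d + 1) = k + 1 + d by ring] at h2
    rw [valuesDown, queenSafe, h2]
    simpa [and_assoc] using h1

theorem valuesDown_mem_queenPlacements {g : ZMod 11 → ZMod 11} (h0 : g 0 = 0) (hg : g.Injective)
    (hadd : (fun x => g x + x).Injective) (hsub : (fun x => g x - x).Injective) (k : ℕ)
    (hk : k < 11) : valuesDown g k ∈ queenPlacements k := by
  induction k with
  | zero => simp [valuesDown, queenPlacements, h0]
  | succ k ih =>
    rw [queenPlacements, List.mem_flatMap]
    refine ⟨_, ih (by omega), ?_⟩
    rw [List.mem_map]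
    exact ⟨_, List.mem_filter.2 ⟨List.mem_range.2 (ZMod.val_lt _),
      queenSafe_valuesDown hg hadd hsub k 1 one_pos hk⟩, rfl⟩

/-- Every solution of the toroidal queens problem on the `11 × 11` board is affine. -/
theorem toroidalQueens_affine {g : ZMod 11 → ZMod 11} (hg : g.Injective)
    (hadd : (fun x => g x + x).Injective) (hsub : (fun x => g x - x).Injective) :
    ∃ m, ∀ x, g x = g 0 + m * x := by
  -- Subtracting `g 0` moves the first queen to row `0` and preserves all three injectivities.
  have hmem := valuesDown_mem_queenPlacements (g := fun x => g x - g 0) (by simp)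
    (fun x y h => hg (by simpa using h))
    (fun x y h => hadd (by simp only at h ⊢; linear_combination h))
    (fun x y h => hsub (by simp only at h ⊢; linear_combination h)) 10 (by norm_num)
  obtain ⟨m, -, hm⟩ := queenPlacements_ten _ hmem
  rw [valuesDown_eq_map, List.map_inj_left] at hm
  refine ⟨m, fun x => ?_⟩
  have := hm x.val (by simpa using ZMod.val_lt x)
  have := congrArg (Nat.cast : ℕ → ZMod 11) this
  simp only [ZMod.natCast_mod, Nat.cast_mul, ZMod.natCast_zmod_val] at this
  linear_combination this

/-! ### Tiles in abelian groups and multiplication by primes -/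

/-- The translates of `T` by the members of the family `s` partition the group. -/
def IsTile {ι G : Type*} [AddCommGroup G] (s : ι → G) (T : Set G) : Prop :=
  ∀ x, ∃! i, x - s i ∈ T

/-- The translation action of `k[G]` on functions on `G`. -/
noncomputable def translationHom (k G : Type*) [CommRing k] [AddCommGroup G] :
    AddMonoidAlgebra k G →ₐ[k] Module.End k (G → k) :=
  AddMonoidAlgebra.lift k (Module.End k (G → k)) G
    { toFun := fun g =>
        { toFun := fun f x => f (x - g.toAdd)
          map_add' := fun _ _ => rfl
          map_smul' := fun _ _ => rfl }
      map_one' := by ext; simp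
      map_mul' := fun a b => by ext; simp [sub_sub] }

theorem translationHom_single {k G : Type*} [CommRing k] [AddCommGroup G] (g : G) (f : G → k)
    (x : G) : translationHom k G (AddMonoidAlgebra.single g 1) f x = f (x - g) := by
  simp [translationHom]

theorem translationHom_sum_single {k G ι : Type*} [Fintype ι] [CommRing k] [AddCommGroup G]
    (s : ι → G) (f : G → k) (x : G) :
    translationHom k G (∑ i, AddMonoidAlgebra.single (s i) 1) f x = ∑ i, f (x - s i) := by
  simp [map_sum, translationHom_single]

open Classical in
/-- The number of representations with respect to a prime multiple of the tile, modulo that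
prime. -/
theorem IsTile.card_filter_nsmul {ι G : Type*} [Fintype ι] [AddCommGroup G] {s : ι → G} {T : Set G}
    (h : IsTile s T) (q : ℕ) [hq : Fact q.Prime] (x : G) :
    ((Finset.univ.filter fun i => x - q • s i ∈ T).card : ZMod q) =
      (Fintype.card ι : ZMod q) ^ (q - 1) := by
  set F : AddMonoidAlgebra (ZMod q) G := ∑ i, AddMonoidAlgebra.single (s i) 1 with hF
  -- Frobenius in characteristic `q`.
  have hpow : F ^ q = ∑ i, AddMonoidAlgebra.single (q • s i) 1 := by
    have : CharP (AddMonoidAlgebra (ZMod q) G) q :=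
      charP_of_injective_algebraMap (algebraMap (ZMod q) (AddMonoidAlgebra (ZMod q) G)).injective q
    rw [hF, sum_pow_char]
    simp [AddMonoidAlgebra.single_pow]
  set f : G → ZMod q := fun x => if x ∈ T then 1 else 0 with hf
  have h1 : translationHom (ZMod q) G F f = fun _ => 1 := by
    ext x
    rw [hF, translationHom_sum_single]
    obtain ⟨i, hi, hu⟩ := h x
    rw [Finset.sum_eq_single i (fun j _ hj => if_neg fun hT => hj (hu j hT)) (by simp)]
    exact if_pos hi
  have h2 : ∀ n : ℕ, translationHom (ZMod q) G (F ^ n) (fun _ => 1) =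
      fun _ => (Fintype.card ι : ZMod q) ^ n := by
    intro n
    induction n with
    | zero => simp
    | succ n ih =>
      rw [pow_succ', map_mul, Module.End.mul_apply, ih]
      ext x
      rw [hF, translationHom_sum_single]
      simp [pow_succ']
  -- One factor `F` turns the indicator of `T` into the constant 1; each of the other `q - 1`
  -- multiplies a constant by the number of cells.
  have h3 : translationHom (ZMod q) G (F ^ q) f x = (Fintype.card ι : ZMod q) ^ (q - 1) := by
    have hF : F ^ q = F ^ (q - 1) * F := (pow_sub_one_mul hq.out.ne_zero F).symm
    rw [hF, map_mul, Module.End.mul_apply, h1, h2]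
  rw [hpow, translationHom_sum_single] at h3
  rw [← h3]
  simp [hf]

/-- A tiling by a prime number of cells is periodic. -/
theorem IsTile.sub_nsmul_mem {ι G : Type*} [Fintype ι] [AddCommGroup G] {s : ι → G} {T : Set G}
    (h : IsTile s T) (hp : (Fintype.card ι).Prime) {i₀ : ι} (h0 : s i₀ = 0) {x : G} (hx : x ∈ T)
    (i : ι) : x - Fintype.card ι • s i ∈ T := by
  classical
  have := Fact.mk hp
  have hc := h.card_filter_nsmul (Fintype.card ι) x
  rw [CharP.cast_eq_zero (ZMod _) (Fintype.card ι), zero_pow (by have := hp.two_le; omega),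
    ZMod.natCast_eq_zero_iff] at hc
  -- The count is a multiple of the number of cells, and the zero cell makes it positive, so every
  -- cell is counted.
  have hpos : 0 < (Finset.univ.filter fun i => x - Fintype.card ι • s i ∈ T).card :=
    Finset.card_pos.2 ⟨i₀, by simpa [h0] using hx⟩
  have hle := Nat.le_of_dvd hpos hc
  have : (Finset.univ.filter fun i => x - Fintype.card ι • s i ∈ T) = Finset.univ :=
    Finset.eq_univ_of_card _ (le_antisymm (Finset.card_le_univ _) hle)
  simpa using this.ge (Finset.mem_univ i)

theorem IsTile.card_mul_card {ι G : Type*} [Fintype ι] [AddCommGroup G] [Fintype G]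
    {s : ι → G} {T : Set G} [Fintype T] (h : IsTile s T) :
    Fintype.card T * Fintype.card ι = Fintype.card G := by
  rw [← Fintype.card_prod]
  refine Fintype.card_of_bijective (f := fun p : T × ι => (p.1 : G) + s p.2) ⟨?_, fun x => ?_⟩
  · rintro ⟨⟨t, ht⟩, i⟩ ⟨⟨t', ht'⟩, i'⟩ e
    simp only at e
    obtain ⟨j, -, hu⟩ := h (t + s i)
    have hi : i = i' := (hu i (by simpa using ht)).trans (hu i' (by simpa [e] using ht')).symm
    subst hi
    simpa using e
  · obtain ⟨i, hi, -⟩ := h x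
    exact ⟨⟨⟨_, hi⟩, i⟩, by simp⟩

/-- In a finite group, multiplying the cells of a tile by a prime not dividing their number gives
a tile with the same translation set. -/
theorem IsTile.nsmul_prime {ι G : Type*} [Fintype ι] [AddCommGroup G] [Finite G] {s : ι → G}
    {T : Set G} (h : IsTile s T) {q : ℕ} (hq : q.Prime) (hqi : ¬ q ∣ Fintype.card ι) :
    IsTile (fun i => q • s i) T := by
  classical
  have := Fact.mk hq
  have := Fintype.ofFinite G
  have hex : ∀ x, ∃ i, x - q • s i ∈ T := by
    intro x
    by_contra! hc
    have := h.card_filter_nsmul q x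
    rw [Finset.filter_false_of_mem (fun i _ => hc i), Finset.card_empty, Nat.cast_zero] at this
    exact hqi ((ZMod.natCast_eq_zero_iff _ _).1 (pow_eq_zero_iff
      (by have := hq.two_le; omega) |>.1 this.symm))
  -- The new translates cover, and the cardinalities agree with those of the old tiling, so there is
  -- no overlap.
  have hbij : Function.Bijective (fun p : T × ι => (p.1 : G) + q • s p.2) := by
    rw [Fintype.bijective_iff_surjective_and_card, Fintype.card_prod, h.card_mul_card]
    refine ⟨fun x => ?_, rfl⟩
    obtain ⟨i, hi⟩ := hex x
    exact ⟨⟨⟨_, hi⟩, i⟩, by simp⟩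
  intro x
  obtain ⟨i, hi⟩ := hex x
  refine ⟨i, hi, fun j hj => ?_⟩
  have := hbij.1 (a₁ := ⟨⟨_, hj⟩, j⟩) (a₂ := ⟨⟨_, hi⟩, i⟩) (by simp)
  exact congrArg Prod.snd this

/-! ### Reduction modulo 11 and linearity of the tile set -/

/-- A function on `Kⁿ` that is affine with a nonzero slope on each line parallel to a coordinate
axis is affine. -/
theorem exists_affine_of_affine_on_axes {ι K : Type*} [Fintype ι] [DecidableEq ι] [Field K]
    {f : (ι → K) → K} {m : ι → (ι → K) → K} (hm : ∀ i x, m i x ≠ 0)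
    (hf : ∀ i x u, f (x + Pi.single i u) = f x + m i x * u) :
    ∀ x, f x = f 0 + ∑ i, m i 0 * x i := by
  have hconst : ∀ i k x w, m i (x + Pi.single k w) = m i x := by
    intro i k x w
    -- Going round a rectangle in both orders shows that the slope along `i` is itself affine in
    -- `w`.
    have key : ∀ w, m i (x + Pi.single k w) = m i x + w * (m k (x + Pi.single i 1) - m k x) := by
      intro w
      have h1 := hf i (x + Pi.single k w) 1
      rw [add_right_comm, hf k, hf i, hf k] at h1
      linear_combination -h1
    by_cases h0 : m k (x + Pi.single i 1) - m k x = 0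
    · rw [key, h0]; ring
    -- A nonconstant affine slope would vanish at this `w`.
    · refine absurd ?_ (hm i (x + Pi.single k (-m i x / (m k (x + Pi.single i 1) - m k x))))
      rw [key]
      field_simp
      ring
  have hsum : ∀ (x : ι → K) (s : Finset ι), (∀ i, m i (∑ k ∈ s, Pi.single k (x k)) = m i 0) ∧
      f (∑ k ∈ s, Pi.single k (x k)) = f 0 + ∑ k ∈ s, m k 0 * x k := by
    intro x s
    induction s using Finset.induction_on with
    | empty => simp
    | insert a s ha ih =>
      rw [Finset.sum_insert ha, Finset.sum_insert ha, add_comm]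
      refine ⟨fun i => by rw [hconst, ih.1], ?_⟩
      rw [hf, ih.1, ih.2]
      ring
  intro x
  simpa [Finset.univ_sum_single] using (hsum x Finset.univ).2

/-- The displacements from the centre of a cross to the centres of its cubes. -/
def crossStep (R : Type*) [Ring R] {n : ℕ} : Option (Fin n × Bool) → Fin n → R
  | none => 0
  | some (i, true) => Pi.single i 1
  | some (i, false) => -Pi.single i 1

theorem intCast_crossStep (R : Type*) [Ring R] {n : ℕ} (a : Option (Fin n × Bool)) (j : Fin n) :
    ((crossStep ℤ a j : ℤ) : R) = crossStep R a j := by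
  rcases a with _ | ⟨i, _ | _⟩ <;> simp [crossStep, Pi.single_apply, apply_ite (Int.cast : ℤ → R)]

/-- A tiling of `ℤ⁵` by crosses is the preimage of a tiling of `(ℤ/11)⁵` by crosses. -/
theorem IsTile.exists_mod_eleven {T : Set (Fin 5 → ℤ)} (hT : IsTile (crossStep ℤ) T) :
    ∃ U : Set (Fin 5 → ZMod 11), (∀ z, z ∈ T ↔ (fun i => (z i : ZMod 11)) ∈ U) ∧
      IsTile (crossStep (ZMod 11)) U := by
  have hper : ∀ a, ∀ x ∈ T, x - 11 • crossStep ℤ a ∈ T := fun a x hx =>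
    hT.sub_nsmul_mem (by simp; norm_num) (i₀ := none) rfl hx a
  let H : AddSubgroup (Fin 5 → ℤ) :=
    { carrier := {w | ∀ x, x ∈ T ↔ x + 11 • w ∈ T}
      zero_mem' := by simp
      add_mem' := fun {a b} ha hb x => by rw [ha x, hb, smul_add, add_assoc]
      neg_mem' := fun {a} ha x => by rw [ha (x + 11 • -a)]; simp }
  -- The cells `-e_i` and `e_i` give the two implications.
  have hsingle : ∀ i, Pi.single i 1 ∈ H := by
    intro i x
    refine ⟨fun hx => ?_, fun hx => ?_⟩
    · simpa [crossStep] using hper (some (i, false)) x hx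
    · simpa [crossStep] using hper (some (i, true)) _ hx
  have hH : ∀ w, w ∈ H := by
    intro w
    rw [← Finset.univ_sum_single w]
    refine H.sum_mem fun i _ => ?_
    have := H.zsmul_mem (hsingle i) (w i)
    rwa [← Pi.single_smul, smul_eq_mul, mul_one] at this
  have hiff : ∀ z, z ∈ T ↔ ∃ y ∈ T, (fun i => (y i : ZMod 11)) = fun i => (z i : ZMod 11) := by
    refine fun z => ⟨fun hz => ⟨z, hz, rfl⟩, ?_⟩
    rintro ⟨y, hy, he⟩
    have hdvd : ∀ i, ∃ w, z i - y i = 11 * w := fun i => by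
      have := (ZMod.intCast_eq_intCast_iff_dvd_sub (y i) (z i) 11).1 (congrFun he i)
      exact this
    choose w hw using hdvd
    have : z = y + 11 • w := by
      ext i
      have := hw i
      simp
      omega
    rw [this]
    exact (hH w y).1 hy
  refine ⟨{u | ∃ y ∈ T, (fun i => (y i : ZMod 11)) = u}, hiff, fun x => ?_⟩
  obtain ⟨z, rfl⟩ : ∃ z : Fin 5 → ℤ, (fun i => (z i : ZMod 11)) = x := by
    choose z hz using fun i => ZMod.intCast_surjective (x i)
    exact ⟨z, funext hz⟩
  have hsub : ∀ a, (fun i => (z i : ZMod 11)) - crossStep (ZMod 11) a =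
      fun i => (((z - crossStep ℤ a) i : ℤ) : ZMod 11) := by
    intro a
    ext i
    simp [← intCast_crossStep (ZMod 11) a i]
  simp only [Set.mem_ofPred_eq, hsub, ← hiff]
  exact hT z

theorem IsTile.smul_crossStep {U : Set (Fin 5 → ZMod 11)} (hU : IsTile (crossStep (ZMod 11)) U)
    {k : ZMod 11} (hk : k ≠ 0) : IsTile (fun a => k • crossStep (ZMod 11) a) U := by
  -- Since 2 is a primitive root modulo 11, the single multiplier prime 2 suffices.
  obtain ⟨m, rfl⟩ : ∃ m : ℕ, k = 2 ^ m := by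
    have : ∀ k : ZMod 11, k ≠ 0 → ∃ m ∈ Finset.range 11, k = 2 ^ m := by decide +kernel
    obtain ⟨m, -, h⟩ := this k hk
    exact ⟨m, h⟩
  clear hk
  induction m with
  | zero => simpa using hU
  | succ m ih =>
    convert ih.nsmul_prime Nat.prime_two (by simp) using 2 with a
    rw [pow_succ', mul_smul, two_smul, two_smul]

/-- For `k ≠ 0` the point `t' + k • a = t + k • b` would be covered twice by the dilated cross. The
choices of `a` and `b` below give the row and diagonal conditions for queens. -/
theorem IsTile.eq_of_smul_crossStep {U : Set (Fin 5 → ZMod 11)}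
    (hU : IsTile (crossStep (ZMod 11)) U) {k : ZMod 11} {a b : Option (Fin 5 × Bool)} (hab : a ≠ b)
    {t t' : Fin 5 → ZMod 11} (ht : t ∈ U) (ht' : t' ∈ U)
    (h : t - t' = k • (crossStep (ZMod 11) a - crossStep (ZMod 11) b)) : k = 0 := by
  by_contra hk
  obtain ⟨c, -, hc⟩ := hU.smul_crossStep hk (t' + k • crossStep (ZMod 11) a)
  refine hab ((hc a (by simpa using ht')).trans (hc b ?_).symm)
  have : t = t' + k • crossStep (ZMod 11) a - k • crossStep (ZMod 11) b := by
    rw [add_sub_assoc, ← smul_sub, ← h]; abel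
  simpa [← this] using ht

theorem IsTile.eq_zero_of_single {U : Set (Fin 5 → ZMod 11)}
    (hU : IsTile (crossStep (ZMod 11)) U) {t : Fin 5 → ZMod 11} {i : Fin 5} {u : ZMod 11}
    (ht : t ∈ U) (ht' : t + Pi.single i u ∈ U) : u = 0 := by
  refine hU.eq_of_smul_crossStep (a := some (i, true)) (b := none) (by simp) ht' ht ?_
  simp [crossStep, ← Pi.single_smul]

theorem IsTile.eq_zero_of_single_add {U : Set (Fin 5 → ZMod 11)}
    (hU : IsTile (crossStep (ZMod 11)) U) {t : Fin 5 → ZMod 11} {i j : Fin 5} {u : ZMod 11}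
    (ht : t ∈ U) (ht' : t + Pi.single i u + Pi.single j u ∈ U) : u = 0 := by
  refine hU.eq_of_smul_crossStep (a := some (i, true)) (b := some (j, false)) (by simp) ht' ht ?_
  simp [crossStep, ← Pi.single_smul, add_assoc]

theorem IsTile.eq_zero_of_single_sub {U : Set (Fin 5 → ZMod 11)}
    (hU : IsTile (crossStep (ZMod 11)) U) {t : Fin 5 → ZMod 11} {i j : Fin 5} (hij : i ≠ j)
    {u : ZMod 11} (ht : t ∈ U) (ht' : t + Pi.single i u + Pi.single j (-u) ∈ U) : u = 0 := by
  refine hU.eq_of_smul_crossStep (a := some (i, true)) (b := some (j, true)) (by simp [hij]) ht' ht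
    ?_
  simp only [crossStep, smul_sub, ← Pi.single_smul, smul_eq_mul, mul_one, Pi.single_neg]
  abel

/-- The tile set meets each line parallel to a coordinate axis. -/
theorem IsTile.exists_add_single_mem {U : Set (Fin 5 → ZMod 11)}
    (hU : IsTile (crossStep (ZMod 11)) U) (x : Fin 5 → ZMod 11) (j : Fin 5) :
    ∃ v, x + Pi.single j v ∈ U := by
  classical
  -- The axis lines through points of `U` are disjoint, and `11 * |U| = 11 ^ 5`, so they fill the
  -- group.
  have hbij : Function.Bijective (fun p : U × ZMod 11 =>
      (p.1 : Fin 5 → ZMod 11) - Pi.single j p.2) := by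
    rw [Fintype.bijective_iff_injective_and_card]
    constructor
    · rintro ⟨⟨t, ht⟩, u⟩ ⟨⟨t', ht'⟩, u'⟩ e
      simp only at e
      have e' : t = t' + Pi.single j (u - u') := by
        rw [Pi.single_sub]; linear_combination (exp := 1) e
      have hu := hU.eq_zero_of_single ht' (e' ▸ ht)
      rw [hu, Pi.single_zero, add_zero] at e'
      rw [sub_eq_zero] at hu
      simp [hu, e']
    · rw [← hU.card_mul_card]
      simp
  obtain ⟨⟨⟨t, ht⟩, v⟩, h⟩ := hbij.2 x
  exact ⟨v, by simpa [← h] using ht⟩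

/-- A tiling of `(ℤ/11)⁵` by crosses is a lattice tiling. -/
theorem IsTile.exists_linear {U : Set (Fin 5 → ZMod 11)}
    (hU : IsTile (crossStep (ZMod 11)) U) : ∃ (a : Fin 5 → ZMod 11) (b : ZMod 11),
    ∀ x, x ∈ U ↔ b + ∑ i, a i * x i = 0 := by
  choose f hf using fun x => hU.exists_add_single_mem x 0
  have huniq : ∀ {x v}, x + Pi.single 0 v ∈ U → f x = v := by
    intro x v h
    have := hU.eq_zero_of_single (i := 0) (u := v - f x) (hf x)
      (by rwa [add_assoc, ← Pi.single_add, add_sub_cancel])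
    exact (sub_eq_zero.1 this).symm
  have hslope : ∀ i x, ∃ m, m ≠ 0 ∧ ∀ u, f (x + Pi.single i u) = f x + m * u := by
    intro i x
    by_cases hi : i = 0
    · subst hi
      -- A shift along axis `0` is compensated by the opposite change of `f`.
      refine ⟨-1, by decide, fun u => huniq ?_⟩
      convert hf x using 1
      rw [add_assoc, ← Pi.single_add]
      congr 2
      ring
    have hmem : ∀ u, x + Pi.single i u + Pi.single 0 (f (x + Pi.single i u)) ∈ U := fun u => hf _
    have hdiff : ∀ u v : ZMod 11, x + Pi.single i v + Pi.single 0 (f (x + Pi.single i v)) =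
        x + Pi.single i u + Pi.single 0 (f (x + Pi.single i u)) + Pi.single i (v - u) +
          Pi.single 0 (f (x + Pi.single i v) - f (x + Pi.single i u)) := by
      intro u v
      simp only [Pi.single_sub]
      abel
    have hinj : (fun u => f (x + Pi.single i u)).Injective := by
      intro u v h
      have h' := hdiff u v
      simp only at h
      rw [h, sub_self, Pi.single_zero, add_zero] at h'
      have := hU.eq_zero_of_single (h ▸ hmem u) (h' ▸ hmem v)
      exact (sub_eq_zero.1 this).symm
    obtain ⟨m, hm⟩ := toroidalQueens_affine hinj
      (fun u v h => by
        have h' := hdiff u v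
        rw [show f (x + Pi.single i v) - f (x + Pi.single i u) = -(v - u) by
          simp only at h; linear_combination -h] at h'
        exact (sub_eq_zero.1 (hU.eq_zero_of_single_sub hi (hmem u) (h' ▸ hmem v))).symm)
      (fun u v h => by
        have h' := hdiff u v
        rw [show f (x + Pi.single i v) - f (x + Pi.single i u) = v - u by
          simp only at h; linear_combination -h] at h'
        exact (sub_eq_zero.1 (hU.eq_zero_of_single_add (hmem u) (h' ▸ hmem v))).symm)
    simp only [Pi.single_zero, add_zero] at hm
    refine ⟨m, fun h0 => ?_, hm⟩
    have := hinj (a₁ := 0) (a₂ := 1) (by simp only [hm, h0, zero_mul])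
    exact absurd this (by decide)
  choose m hm hfm using hslope
  have : Fact (Nat.Prime 11) := ⟨by norm_num⟩
  refine ⟨fun i => m i 0, f 0, fun x => ?_⟩
  rw [← exists_affine_of_affine_on_axes hm hfm]
  refine ⟨fun hx => huniq (by simpa using hx), fun hx => ?_⟩
  simpa [hx] using hf x

/-- Up to the order and the signs of the coordinates, there is one lattice tiling of `(ℤ/11)⁵` by
crosses. -/
theorem IsTile.exists_perm_sign {U : Set (Fin 5 → ZMod 11)} (hU : IsTile (crossStep (ZMod 11)) U) :
    ∃ (σ : Equiv.Perm (Fin 5)) (ε : Fin 5 → ℤˣ) (b : ZMod 11), ∀ x, x ∈ U ↔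
      b + ∑ i, ((ε i : ℤ) : ZMod 11) * ((σ i : ℕ) + 1) * x i = 0 := by
  obtain ⟨a, b, hab⟩ := hU.exists_linear
  -- Two cells with the same value of the linear form would cover a common point from centres in
  -- `U`.
  have hinj : ∀ c d : Option (Fin 5 × Bool), c ≠ d →
      ∑ i, a i * crossStep (ZMod 11) c i ≠ ∑ i, a i * crossStep (ZMod 11) d i := by
    intro c d hcd h
    obtain ⟨t, ht⟩ : ∃ t, t ∈ U := ⟨_, (hU 0).exists.choose_spec⟩
    obtain ⟨e, -, he⟩ := hU (t + crossStep (ZMod 11) c)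
    refine hcd ((he c (by simpa using ht)).trans (he d ?_).symm)
    rw [hab] at ht ⊢
    rw [← ht]
    simp only [Pi.sub_apply, Pi.add_apply, mul_sub, mul_add, Finset.sum_sub_distrib,
      Finset.sum_add_distrib, h]
    ring
  have hsum : ∀ i (δ : Bool), ∑ j, a j * crossStep (ZMod 11) (some (i, δ)) j =
      if δ then a i else -a i := by
    intro i δ
    cases δ <;> simp [crossStep, Pi.single_apply]
  have ha0 : ∀ i, a i ≠ 0 := fun i h => hinj (some (i, true)) none (by simp)
    (by rw [hsum]; simp [crossStep, h])
  have hne : ∀ i j, i ≠ j → a i ≠ a j ∧ a i ≠ -a j := fun i j hij =>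
    ⟨fun h => hinj (some (i, true)) (some (j, true)) (by simp [hij]) (by simpa [hsum] using h),
      fun h => hinj (some (i, true)) (some (j, false)) (by simp) (by simpa [hsum] using h)⟩
  have hrep : ∀ a : ZMod 11, a ≠ 0 → ∃ (j : Fin 5) (ε : ℤˣ),
      a = ((ε : ℤ) : ZMod 11) * ((j : ℕ) + 1) := by decide +kernel
  choose σ ε hσ using fun i => hrep (a i) (ha0 i)
  have hσinj : σ.Injective := by
    intro i j h
    by_contra hij
    obtain ⟨h1, h2⟩ := hne i j hij
    have hi := hσ i
    rw [h] at hi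
    rcases Int.units_eq_one_or (ε i) with hei | hei <;>
      rcases Int.units_eq_one_or (ε j) with hej | hej
    all_goals
      have hj := hσ j
      rw [hei] at hi
      rw [hej] at hj
      first
        | exact h1 (hi.trans hj.symm)
        | exact h2 (by rw [hi, hj]; simp)
  refine ⟨Equiv.ofBijective σ (Finite.injective_iff_bijective.1 hσinj), ε, b, fun x => ?_⟩
  rw [hab]
  simp only [Equiv.ofBijective_apply, ← hσ]

/-! ### Crosses in `ℝⁿ` and tiles of `ℤⁿ` -/

theorem mem_cross_iff {n : ℕ} [NeZero n] {c x : EuclideanSpace ℝ (Fin n)} :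
    x ∈ cross c ↔ ∃ i, |x i - c i| ≤ 3 / 2 ∧ ∀ j ≠ i, |x j - c j| ≤ 1 / 2 := by
  simp only [cross, unitCube, Set.mem_union, Set.mem_iUnion, Set.mem_ofPred_eq, PiLp.add_apply,
    PiLp.sub_apply, PiLp.single_apply]
  constructor
  · rintro (h | ⟨i, h | h⟩)
    · exact ⟨0, (h 0).trans (by norm_num), fun j _ => h j⟩
    · refine ⟨i, ?_, fun j hj => by simpa [hj] using h j⟩
      have := abs_le.1 (h i)
      rw [if_pos rfl] at this
      exact abs_le.2 ⟨by linarith, by linarith⟩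
    · refine ⟨i, ?_, fun j hj => by simpa [hj] using h j⟩
      have := abs_le.1 (h i)
      rw [if_pos rfl] at this
      exact abs_le.2 ⟨by linarith, by linarith⟩
  · rintro ⟨i, hi, h⟩
    rw [abs_le] at hi
    by_cases h1 : 1 / 2 < x i - c i
    · refine Or.inr ⟨i, Or.inl fun j => ?_⟩
      rcases eq_or_ne j i with rfl | hj
      · rw [if_pos rfl]; exact abs_le.2 ⟨by linarith, by linarith⟩
      · simpa [hj] using h j hj
    by_cases h2 : x i - c i < -(1 / 2)
    · refine Or.inr ⟨i, Or.inr fun j => ?_⟩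
      rcases eq_or_ne j i with rfl | hj
      · rw [if_pos rfl]; exact abs_le.2 ⟨by linarith, by linarith⟩
      · simpa [hj] using h j hj
    · refine Or.inl fun j => ?_
      rcases eq_or_ne j i with rfl | hj
      · exact abs_le.2 ⟨by linarith, by linarith⟩
      · exact h j hj

theorem cross_injective {n : ℕ} [NeZero n] :
    (cross : EuclideanSpace ℝ (Fin n) → Set (EuclideanSpace ℝ (Fin n))).Injective := by
  have hle : ∀ c c' : EuclideanSpace ℝ (Fin n), cross c = cross c' → ∀ i, c i ≤ c' i := by
    intro c c' h i
    -- The tip of the arm has the largest `i`-th coordinate in the cross.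
    have hmem : c + EuclideanSpace.single i (3 / 2) ∈ cross c' := by
      rw [← h, mem_cross_iff]
      exact ⟨i, by norm_num [abs_of_nonneg], fun j hj => by simp [hj]⟩
    obtain ⟨k, hk, hj⟩ := mem_cross_iff.1 hmem
    have hi : |(c + EuclideanSpace.single i (3 / 2 : ℝ)) i - c' i| ≤ 3 / 2 := by
      rcases eq_or_ne i k with rfl | hik
      · exact hk
      · exact (hj i hik).trans (by norm_num)
    have := (abs_le.1 hi).2
    simp at this
    linarith
  intro c c' h
  ext i
  exact le_antisymm (hle c c' h i) (hle c' c h.symm i)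

/-- The point with given integer coordinates. -/
noncomputable def intPoint {n : ℕ} (z : Fin n → ℤ) : EuclideanSpace ℝ (Fin n) :=
  WithLp.toLp 2 fun i => (z i : ℝ)

@[simp]
theorem intPoint_apply {n : ℕ} (z : Fin n → ℤ) (i : Fin n) : intPoint z i = z i := rfl

theorem intPoint_injective {n : ℕ} : (intPoint (n := n)).Injective := by
  intro z w h
  ext i
  have := congrArg (fun x : EuclideanSpace ℝ (Fin n) => x i) h
  simpa using this

theorem mem_cross_intPoint {n : ℕ} {z : Fin n → ℤ} {x : EuclideanSpace ℝ (Fin n)} :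
    x ∈ cross (intPoint z) ↔ ∃ a, x ∈ unitCube (intPoint (z + crossStep ℤ a)) := by
  have hp : ∀ i, intPoint z + EuclideanSpace.single i (1 : ℝ) =
      intPoint (z + crossStep ℤ (some (i, true))) := by
    intro i
    ext j
    simp [crossStep, Pi.single_apply]
  have hm : ∀ i, intPoint z - EuclideanSpace.single i (1 : ℝ) =
      intPoint (z + crossStep ℤ (some (i, false))) := by
    intro i
    ext j
    simp [crossStep, Pi.single_apply, sub_eq_add_neg, apply_ite (Int.cast : ℤ → ℝ)]
  simp only [cross, hp, hm, Set.mem_union, Set.mem_iUnion, Option.exists, Prod.exists,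
    Bool.exists_bool]
  simp [crossStep, or_comm]

theorem intPoint_mem_unitCube {n : ℕ} {z w : Fin n → ℤ} :
    intPoint w ∈ unitCube (intPoint z) ↔ w = z := by
  refine ⟨fun h => ?_, fun h => by simp [h, unitCube]⟩
  ext i
  have := abs_le.1 (h i)
  simp only [intPoint_apply] at this
  have h1 : (w i : ℝ) < z i + 1 := by linarith
  have h2 : (z i : ℝ) < w i + 1 := by linarith
  norm_cast at h1 h2
  omega

theorem mem_interior_unitCube {n : ℕ} (c : EuclideanSpace ℝ (Fin n)) :
    c ∈ interior (unitCube c) := by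
  refine mem_interior.2 ⟨⋂ i, {x | |x i - c i| < 1 / 2}, fun x hx i => ?_, ?_, ?_⟩
  · exact (Set.mem_iInter.1 hx i).le
  · exact isOpen_iInter_of_finite fun i => isOpen_lt (by fun_prop) (by fun_prop)
  · simp

/-- Such points avoid the faces of all cubes with integer centres, so a nonempty open overlap of two
crosses contains a point lying in a single cube. -/
theorem dense_irrational_coordinates (n : ℕ) :
    Dense {x : EuclideanSpace ℝ (Fin n) | ∀ i, Irrational (x i)} := by
  have h := dense_pi (s := fun _ : Fin n => {x : ℝ | Irrational x}) Set.univ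
    fun _ _ => dense_irrational
  convert h.preimage (PiLp.homeomorph 2 (fun _ : Fin n => ℝ)).isOpenMap using 1
  ext x
  simp only [Set.mem_pi, Set.mem_univ, true_imp_iff, Set.mem_preimage, Set.mem_ofPred_eq]
  rfl

theorem IsTile.isZCrossTiling {n : ℕ} [NeZero n] {T : Set (Fin n → ℤ)}
    (hT : IsTile (crossStep ℤ) T) : IsZCrossTiling ((fun z => cross (intPoint z)) '' T) where
  isCross := by
    rintro _ ⟨z, -, rfl⟩
    exact ⟨_, rfl⟩
  covers := by
    refine Set.eq_univ_of_forall fun x => ?_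
    obtain ⟨a, ha, -⟩ := hT fun i => round (x i)
    refine ⟨_, ⟨_, ha, rfl⟩, mem_cross_intPoint.2 ⟨a, fun i => ?_⟩⟩
    simpa using abs_sub_round (x i)
  disjoint_interiors := by
    rintro _ ⟨z, hz, rfl⟩ _ ⟨w, hw, rfl⟩ hne
    by_contra hd
    obtain ⟨x, hx, hirr⟩ := (dense_irrational_coordinates n).inter_open_nonempty _
      (isOpen_interior.inter isOpen_interior) (Set.not_disjoint_iff_nonempty_inter.1 hd)
    obtain ⟨a, ha⟩ := mem_cross_intPoint.1 (interior_subset hx.1)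
    obtain ⟨b, hb⟩ := mem_cross_intPoint.1 (interior_subset hx.2)
    have heq : z + crossStep ℤ a = w + crossStep ℤ b := by
      ext i
      have h1 := abs_le.1 (ha i)
      have h2 := abs_le.1 (hb i)
      have hi := hirr i
      simp only [intPoint_apply] at h1 h2
      generalize (z + crossStep ℤ a) i = p at *
      generalize (w + crossStep ℤ b) i = q at *
      have hp : x i ≠ ((p + 1 / 2 : ℚ) : ℝ) := hi.ne_rat _
      have hq : x i ≠ ((q + 1 / 2 : ℚ) : ℝ) := hi.ne_rat _
      push_cast at hp hq
      have h3 : (p : ℝ) < q + 1 := by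
        have := lt_of_le_of_ne (by linarith : x i ≤ q + 1 / 2) hq
        linarith
      have h4 : (q : ℝ) < p + 1 := by
        have := lt_of_le_of_ne (by linarith : x i ≤ p + 1 / 2) hp
        linarith
      norm_cast at h3 h4
      omega
    obtain ⟨c, -, hc⟩ := hT (z + crossStep ℤ a)
    have hab : a = b := (hc a (by simpa using hz)).trans (hc b (by simpa [heq] using hw)).symm
    rw [hab] at heq
    exact hne (by rw [add_right_cancel heq])
  integer_centres := by
    rintro c ⟨z, -, hz⟩ i
    exact ⟨z i, by rw [← cross_injective hz]; rfl⟩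

theorem IsZCrossTiling.exists_isTile {n : ℕ} [NeZero n] {L : Set (Set (EuclideanSpace ℝ (Fin n)))}
    (hL : IsZCrossTiling L) :
    ∃ T : Set (Fin n → ℤ), IsTile (crossStep ℤ) T ∧ L = (fun z => cross (intPoint z)) '' T := by
  have hrep : ∀ K ∈ L, ∃ z, cross (intPoint z) = K := by
    intro K hK
    obtain ⟨c, rfl⟩ := hL.isCross K hK
    choose z hz using hL.integer_centres c hK
    refine ⟨z, congrArg cross ?_⟩
    ext i
    rw [hz, intPoint_apply]
  refine ⟨{z | cross (intPoint z) ∈ L}, fun x => ?_, ?_⟩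
  · obtain ⟨K, hK, hx⟩ := (hL.covers ▸ Set.mem_univ (intPoint x) : intPoint x ∈ ⋃₀ L)
    obtain ⟨z, rfl⟩ := hrep K hK
    obtain ⟨a, ha⟩ := mem_cross_intPoint.1 hx
    obtain rfl := intPoint_mem_unitCube.1 ha
    -- An integer point is interior to each cross having it as the centre of a cell, so two
    -- different crosses of the tiling cannot share it.
    have hint : ∀ w b, z + crossStep ℤ a - crossStep ℤ b = w →
        intPoint (z + crossStep ℤ a) ∈ interior (cross (intPoint w)) := by
      rintro _ b rfl
      refine interior_mono (fun y hy => mem_cross_intPoint.2 ⟨b, ?_⟩) (mem_interior_unitCube _)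
      simpa using hy
    refine ⟨a, by simpa using hK, fun b hb => ?_⟩
    by_contra hab
    refine Set.disjoint_left.1 (hL.disjoint_interiors hb hK fun h => hab ?_) (hint _ b rfl)
      (hint _ a (by simp))
    have := intPoint_injective (cross_injective h)
    have hstep : crossStep ℤ a = crossStep ℤ b := by
      rw [sub_eq_iff_eq_add] at this
      exact add_left_cancel this
    have hinj : (crossStep ℤ (n := n)).Injective := by
      intro c d hcd
      have h := fun i => congrFun hcd i
      rcases c with _ | ⟨i, _ | _⟩ <;> rcases d with _ | ⟨j, _ | _⟩ <;> try rfl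
      all_goals
        first
          | have h1 := h i
          | have h1 := h j
        simp only [crossStep, Pi.single_apply, Pi.zero_apply, Pi.neg_apply] at h1
        split_ifs at h1 <;> simp_all
    exact (hinj hstep).symm
  · ext K
    refine ⟨fun hK => ?_, ?_⟩
    · obtain ⟨z, rfl⟩ := hrep K hK
      exact ⟨z, hK, rfl⟩
    · rintro ⟨z, hz, rfl⟩
      exact hz

/-! ### Signed permutations, the standard lattice and uniqueness -/

/-- The signed coordinate permutation `x ↦ (ε i * x (σ i))ᵢ`, followed by a translation. -/
noncomputable def signedPerm {n : ℕ} (σ : Equiv.Perm (Fin n)) (ε : Fin n → ℤˣ)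
    (v : EuclideanSpace ℝ (Fin n)) :
    EuclideanSpace ℝ (Fin n) ≃ᵃⁱ[ℝ] EuclideanSpace ℝ (Fin n) :=
  (((LinearIsometryEquiv.piLpCongrLeft 2 ℝ ℝ σ.symm).trans
    (LinearIsometryEquiv.piLpCongrRight 2 fun i =>
      if ε i = 1 then LinearIsometryEquiv.refl ℝ ℝ else LinearIsometryEquiv.neg ℝ)).toAffineIsometryEquiv).trans
        (AffineIsometryEquiv.constVAdd ℝ _ v)

theorem signedPerm_apply {n : ℕ} (σ : Equiv.Perm (Fin n)) (ε : Fin n → ℤˣ)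
    (v x : EuclideanSpace ℝ (Fin n)) (i : Fin n) :
    signedPerm σ ε v x i = v i + (ε i : ℤ) * x (σ i) := by
  rcases Int.units_eq_one_or (ε i) with h | h <;>
    simp [signedPerm, LinearIsometryEquiv.piLpCongrLeft_apply, Equiv.piCongrLeft', h]

theorem signedPerm_image_cross {n : ℕ} [NeZero n] (σ : Equiv.Perm (Fin n)) (ε : Fin n → ℤˣ)
    (v c : EuclideanSpace ℝ (Fin n)) :
    signedPerm σ ε v '' cross c = cross (signedPerm σ ε v c) := by
  have habs : ∀ x i, |signedPerm σ ε v x i - signedPerm σ ε v c i| = |x (σ i) - c (σ i)| := by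
    intro x i
    rw [signedPerm_apply, signedPerm_apply, add_sub_add_left_eq_sub, ← mul_sub, abs_mul]
    rcases Int.units_eq_one_or (ε i) with h | h <;> simp [h]
  have hiff : ∀ x, signedPerm σ ε v x ∈ cross (signedPerm σ ε v c) ↔ x ∈ cross c := by
    intro x
    rw [mem_cross_iff, mem_cross_iff]
    simp only [habs]
    rw [← σ.exists_congr_right (q := fun i => |x i - c i| ≤ 3 / 2 ∧ _)]
    refine exists_congr fun i => and_congr Iff.rfl ?_
    rw [← σ.forall_congr_right (q := fun j => j ≠ σ i → |x j - c j| ≤ 1 / 2)]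
    simp
  ext y
  obtain ⟨x, rfl⟩ := (signedPerm σ ε v).surjective y
  rw [hiff]
  exact (signedPerm σ ε v).injective.mem_set_image

/-- The lattice of the cross tiling. -/
def crossLattice : Set (Fin 5 → ℤ) :=
  {z | ∑ i : Fin 5, ((i : ℕ) + 1 : ZMod 11) * z i = 0}

theorem isTile_crossLattice : IsTile (crossStep ℤ) crossLattice := by
  -- The form takes the values `0, ±1, …, ±5` on the cells: each residue modulo 11 once.
  have hbij : Function.Bijective fun a : Option (Fin 5 × Bool) =>
      ∑ i : Fin 5, ((i : ℕ) + 1 : ZMod 11) * (crossStep ℤ a i : ℤ) := by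
    rw [Fintype.bijective_iff_injective_and_card]
    refine ⟨?_, by simp⟩
    decide +kernel
  have hmem : ∀ (x : Fin 5 → ℤ) a, x - crossStep ℤ a ∈ crossLattice ↔
      ∑ i : Fin 5, ((i : ℕ) + 1 : ZMod 11) * (crossStep ℤ a i : ℤ) =
        ∑ i : Fin 5, ((i : ℕ) + 1 : ZMod 11) * x i := by
    intro x a
    simp only [crossLattice, Set.mem_ofPred_eq, Pi.sub_apply, Int.cast_sub, mul_sub,
      Finset.sum_sub_distrib, sub_eq_zero]
    exact eq_comm
  intro x
  simp only [hmem]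
  exact hbij.existsUnique _

theorem mainTheorem1 :
    ∃ L : Set (Set (EuclideanSpace ℝ (Fin 5))), IsZCrossTiling L ∧
      ∀ L' : Set (Set (EuclideanSpace ℝ (Fin 5))), IsZCrossTiling L' → CongruentTilings L L' := by
  refine ⟨_, isTile_crossLattice.isZCrossTiling, fun L' hL' => ?_⟩
  obtain ⟨T, hT, rfl⟩ := hL'.exists_isTile
  obtain ⟨U, hTU, hU⟩ := hT.exists_mod_eleven
  obtain ⟨σ, ε, b, hσ⟩ := hU.exists_perm_sign
  obtain ⟨t, ht⟩ : ∃ t, t ∈ T := ⟨_, (hT 0).exists.choose_spec⟩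
  -- The isometry on integer points; translating by some `t ∈ T` absorbs the constant `b`, and the
  -- signs cancel because `ε i` squares to 1.
  let F : (Fin 5 → ℤ) → Fin 5 → ℤ := fun z i => t i + ε i * z (σ i)
  have hF : ∀ z, signedPerm σ ε (intPoint t) (intPoint z) = intPoint (F z) := by
    intro z
    ext i
    simp [signedPerm_apply, F]
  have hsq : ∀ i, ((ε i : ℤ) : ZMod 11) * ((ε i : ℤ) : ZMod 11) = 1 := by
    intro i
    rcases Int.units_eq_one_or (ε i) with h | h <;> simp [h]
  have hFT : ∀ z, F z ∈ T ↔ z ∈ crossLattice := by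
    intro z
    rw [hTU, hσ] at ht
    have hsum : ∑ i : Fin 5, ((i : ℕ) + 1 : ZMod 11) * z i =
        ∑ i, ((σ i : ℕ) + 1 : ZMod 11) * z (σ i) :=
      (Equiv.sum_comp σ fun i => ((i : ℕ) + 1 : ZMod 11) * z i).symm
    have hsplit : b + ∑ i, ((ε i : ℤ) : ZMod 11) * ((σ i : ℕ) + 1) * (F z i : ℤ) =
        (b + ∑ i, ((ε i : ℤ) : ZMod 11) * ((σ i : ℕ) + 1) * (t i : ℤ)) +
          ∑ i, ((σ i : ℕ) + 1 : ZMod 11) * z (σ i) := by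
      rw [add_assoc, ← Finset.sum_add_distrib]
      congr 1
      refine Finset.sum_congr rfl fun i _ => ?_
      simp only [F, Int.cast_add, Int.cast_mul]
      linear_combination ((σ i : ℕ) + 1 : ZMod 11) * z (σ i) * hsq i
    rw [hTU, hσ, hsplit, ht, zero_add, ← hsum]
    rfl
  have hFsurj : F.Surjective := by
    intro w
    refine ⟨fun j => ε (σ.symm j) * (w (σ.symm j) - t (σ.symm j)), ?_⟩
    ext i
    rcases Int.units_eq_one_or (ε i) with h | h <;> simp [F, h]
  refine ⟨signedPerm σ ε (intPoint t), ?_⟩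
  ext K
  simp only [Set.mem_image, exists_exists_and_eq_and, signedPerm_image_cross, hF, ← hFT]
  constructor
  · rintro ⟨z, hz, rfl⟩
    exact ⟨_, hz, rfl⟩
  · rintro ⟨w, hw, rfl⟩
    obtain ⟨z, rfl⟩ := hFsurj w
    exact ⟨z, hw, rfl⟩
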